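/- **Protocol.** Let $n,n_z,n_x>0$ be integers, $N=n+n_z+n_x$, let $r,m\ge 0$ be integers with $r+m\le n$, and let $p_{a,z},p_{a,x}>0$ be real. In the BB84-INFO-$z$ protocol Alice chooses $\mathbf i\in\mathbf F_2^N$ uniformly; a pair $(\mathbf b,\mathbf s)$ uniformly among all pairs of strings in $\mathbf F_2^N$ with $|\mathbf b|=n_x$, $|\mathbf s|=n$, $|\mathbf s\oplus\mathbf b|=n+n_x$ (where $|\cdot|$ is the number of 1-bits); and matrices $P_C\in\mathbf F_2^{r\times n}$, $P_K\in\mathbf F_2^{m\times n}$ uniformly among the pairs all of whose $r+m$ rows together are linearly independent; the three choices are independent. In the *inverted-INFO-basis* version she sends the $N$ qubits $|\mathbf i\rangle_{\mathbf b^0}=\bigotimes_k|i_k\rangle_{b^0_k}$, where $\mathbf b^0=\mathbf b\oplus\mathbf s$, $|0\rangle_0,|1\rangle_0$ is the $z$ basis and $|0\rangle_1,|1\rangle_1=(|0\rangle_0\pm|1\rangle_0)/\sqrt2$ is the $x$ basis. Eve applies a joint attack fixed in advance: she attaches a probe in a unit state $|0\rangle_E$ of a complex Hilbert space and applies a unitary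 $U$ to the probe and all the qubits. Bob measures qubit $k$ in the $z$ basis if $b^0_k=0$ and in the $x$ basis if $b^0_k=1$, obtaining $\mathbf j\in\mathbf F_2^N$; that is, $\Pr(\mathbf j\mid\mathbf i,\mathbf b,\mathbf s)=\big\|(\mathrm{id}\otimes\langle\mathbf j|_{\mathbf b^0})\,U(|0\rangle_E\otimes|\mathbf i\rangle_{\mathbf b^0})\big\|^2$. Let $\mathbf c=\mathbf i\oplus\mathbf j$. Let $\mathbf C_I$ be the substring of $\mathbf c$ at the $n$ INFO positions ($s_k=1$), and let $\mathbf C_{T_Z}$, $\mathbf C_{T_X}$ be its substrings at the $n_z$ positions with $s_k=0,b_k=0$ and at the $n_x$ positions with $s_k=0,b_k=1$. The test passes, $\mathbf T=1$, if and only if $|\mathbf C_{T_Z}|\le n_zp_{a,z}$ and $|\mathbf C_{T_X}|\le n_xp_{a,x}$. **Theorem.** Let $\epsilon_{\mathrm{sec}}>0$ be such that $t:=n(p_{a,x}+\epsilon_{\mathrm{sec}})$ is an integer and $p_{a,x}+\epsilon_{\mathrm{sec}}\le\frac12$. Then for every joint attack of Eve, $$\Pr_{\text{inverted-INFO-basis}}\left[\frac{|\mathbf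 C_I|}{n}\ge\frac tn\ \wedge\ \mathbf T=1\right]\le e^{-2\left(\frac{n_x}{n+n_x}\right)^2n\,\epsilon_{\mathrm{sec}}^2}.$$ -/

import Mathlib

noncomputable section

open scoped TensorProduct

namespace BB84

/-! ### Bit strings -/

/-- Bit strings of length `N`: vectors over the field with two elements (so `+` is XOR). The number
of 1-bits of a string `x` is `hammingNorm x`. -/
abbrev BitString (N : ℕ) : Type := Fin N → ZMod 2

/-- The INFO positions determined by `s` (those with `s_k = 1`). -/
abbrev InfoIndex {N : ℕ} (s : BitString N) : Type := {k : Fin N // s k = 1}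

/-- The TEST positions determined by `s` (those with `s_k = 0`). -/
abbrev TestIndex {N : ℕ} (s : BitString N) : Type := {k : Fin N // s k = 0}

/-- The substring of `x` formed by its INFO bits. -/
def infoPart {N : ℕ} (s x : BitString N) : InfoIndex s → ZMod 2 := fun k => x k

/-- The substring of `x` formed by its TEST bits. -/
def testPart {N : ℕ} (s x : BitString N) : TestIndex s → ZMod 2 := fun k => x k

/-! ### Qubits -/

/-- The qubit state `|i⟩_b`: for `b = 0` the computational (`z`) basis state `|i⟩`, and for `b = 1`
the Hadamard (`x`) basis state `(|0⟩ + (-1)^i |1⟩) / √2`. -/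
def qubitKet (b i : ZMod 2) : EuclideanSpace ℂ (ZMod 2) :=
  if b = 0 then EuclideanSpace.single i 1
  else ((Real.sqrt 2 : ℝ) : ℂ)⁻¹ •
    (EuclideanSpace.single 0 1 + (if i = 0 then (1 : ℂ) else -1) • EuclideanSpace.single 1 1)

/-- The state space of `N` qubits, in coordinates with respect to the computational basis. -/
abbrev QubitSpace (N : ℕ) : Type := EuclideanSpace ℂ (BitString N)

/-- The product state `|i⟩_b = ⊗_k |i_k⟩_{b_k}` of `N` qubits. -/
def ket {N : ℕ} (b i : BitString N) : QubitSpace N :=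
  WithLp.toLp 2 fun x => ∏ k, qubitKet (b k) (i k) (x k)

lemma inner_qubitKet (b i j : ZMod 2) :
    inner ℂ (qubitKet b i) (qubitKet b j) = if i = j then (1 : ℂ) else 0 := by
  have h2 : ((Real.sqrt 2 : ℝ) : ℂ)⁻¹ * ((Real.sqrt 2 : ℝ) : ℂ)⁻¹ = 1 / 2 := by
    rw [← mul_inv, ← Complex.ofReal_mul, Real.mul_self_sqrt (by norm_num)]; norm_num
  have hu : (Finset.univ : Finset (ZMod 2)) = {0, 1} := by decide
  have hcases : ∀ x : ZMod 2, x = 0 ∨ x = 1 := by decide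
  by_cases hb : b = 0
  · rcases hcases i with rfl | rfl <;> rcases hcases j with rfl | rfl <;>
      simp [qubitKet, hb, PiLp.inner_apply, hu, -inner_self_eq_norm_sq_to_K]
  · rcases hcases i with rfl | rfl <;> rcases hcases j with rfl | rfl <;>
      simp only [qubitKet, hb, PiLp.inner_apply, hu] <;>
      simp [-inner_self_eq_norm_sq_to_K] <;>
      linear_combination (2 : ℂ) * h2

lemma inner_ket {N : ℕ} (b i j : BitString N) :
    inner ℂ (ket b i) (ket b j) = if i = j then (1 : ℂ) else 0 := by
  have h : inner ℂ (ket b i) (ket b j)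
      = ∏ k, inner ℂ (qubitKet (b k) (i k)) (qubitKet (b k) (j k)) := by
    simp only [PiLp.inner_apply, ket]
    rw [Fintype.prod_sum]
    refine Finset.sum_congr rfl fun x _ => ?_
    simp [Finset.prod_mul_distrib]
  rw [h]
  simp only [inner_qubitKet]
  rw [Finset.prod_ite_zero]
  simp [funext_iff]

lemma orthonormal_ket {N : ℕ} (b : BitString N) : Orthonormal ℂ (ket b) :=
  orthonormal_iff_ite.2 fun i j => inner_ket b i j

/-- For a basis string `b`, the states `|j⟩_b` form an orthonormal basis of the `N`-qubit space. -/
def ketBasis {N : ℕ} (b : BitString N) : OrthonormalBasis (BitString N) ℂ (QubitSpace N) :=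
  OrthonormalBasis.mk (orthonormal_ket b) (by
    rw [(orthonormal_ket b).linearIndependent.span_eq_top_of_card_eq_finrank' (by simp)])

lemma ketBasis_apply {N : ℕ} (b j : BitString N) : ketBasis b j = ket b j := by
  simp [ketBasis]

/-! ### Eve's joint attack and Bob's measurement -/

section Attack

variable {E : Type*} [NormedAddCommGroup E] [InnerProductSpace ℂ E] {N : ℕ}

/-- The partial inner product `id ⊗ ⟨φ|` from the compound system to Eve's system. -/
def partialBra (φ : QubitSpace N) : E ⊗[ℂ] QubitSpace N →ₗ[ℂ] E :=
  (TensorProduct.rid ℂ E).toLinearMap ∘ₗ (innerₛₗ ℂ φ).lTensor E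

lemma partialBra_tmul (φ ψ : QubitSpace N) (e : E) :
    partialBra φ (e ⊗ₜ[ℂ] ψ) = inner ℂ φ ψ • e := by
  simp [partialBra]

/-- `ψ = ∑_j |ψ_j⟩ ⊗ |j⟩_b` with `ψ_j = (id ⊗ ⟨j|_b) ψ`. -/
lemma sum_partialBra_tmul (b : BitString N) (ψ : E ⊗[ℂ] QubitSpace N) :
    ∑ j, partialBra (ket b j) ψ ⊗ₜ[ℂ] ket b j = ψ := by
  induction ψ with
  | zero => simp
  | add x y hx hy => simp only [map_add, TensorProduct.add_tmul, Finset.sum_add_distrib, hx, hy]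
  | tmul e φ =>
    simp only [partialBra_tmul, TensorProduct.smul_tmul, ← TensorProduct.tmul_sum]
    congr 1
    simpa [ketBasis_apply] using (ketBasis b).sum_repr' φ

lemma sum_norm_partialBra_sq (b : BitString N) (ψ : E ⊗[ℂ] QubitSpace N) :
    ∑ j, ‖partialBra (ket b j) ψ‖ ^ 2 = ‖ψ‖ ^ 2 := by
  have h : inner ℂ ψ ψ = ∑ j, inner ℂ (partialBra (ket b j) ψ) (partialBra (ket b j) ψ) := by
    conv_lhs => rw [← sum_partialBra_tmul b ψ]
    rw [sum_inner]
    refine Finset.sum_congr rfl fun i _ => ?_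
    rw [inner_sum]
    simp [TensorProduct.inner_tmul, inner_ket]
  simp only [inner_self_eq_norm_sq_to_K] at h
  apply Complex.ofReal_injective
  push_cast
  exact h.symm.trans (inner_self_eq_norm_sq_to_K (𝕜 := ℂ) ψ)

/-- The law of the outcome `j` when Bob's `N` qubits of the normalized compound state `ψ` of Eve and
Bob are measured, the `k`-th qubit in the `z` basis if `b_k = 0` and in the `x` basis if `b_k = 1`:
the outcome `j` has probability `‖(id ⊗ ⟨j|_b) ψ‖²`. -/
def measurementLaw (b : BitString N) (ψ : E ⊗[ℂ] QubitSpace N) (hψ : ‖ψ‖ = 1) :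
    PMF (BitString N) :=
  PMF.ofFintype (fun j => ENNReal.ofReal (‖partialBra (ket b j) ψ‖ ^ 2)) (by
    rw [← ENNReal.ofReal_sum_of_nonneg (fun _ _ => by positivity), sum_norm_partialBra_sq, hψ]
    simp)

end Attack

/-- A joint attack of Eve on `N` qubits: an initial probe state `|0⟩_E` in her probe space `E` and a
unitary operator on the compound system of her probe and all the qubits. -/
structure JointAttack (E : Type*) [NormedAddCommGroup E] [InnerProductSpace ℂ E] (N : ℕ) where
  probe : E
  norm_probe : ‖probe‖ = 1
  unitary : (E ⊗[ℂ] QubitSpace N) ≃ₗᵢ[ℂ] (E ⊗[ℂ] QubitSpace N)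

section Attack

variable {E : Type*} [NormedAddCommGroup E] [InnerProductSpace ℂ E] {N : ℕ}

/-- The state `U |0⟩_E |i⟩_b` of Eve and Bob after the attack, when Alice sent `|i⟩_b`. -/
def JointAttack.state (A : JointAttack E N) (b i : BitString N) : E ⊗[ℂ] QubitSpace N :=
  A.unitary (A.probe ⊗ₜ[ℂ] ket b i)

lemma JointAttack.norm_state (A : JointAttack E N) (b i : BitString N) : ‖A.state b i‖ = 1 := by
  simp [state, A.norm_probe, (orthonormal_ket b).norm_eq_one i]

/-- The law of Bob's bit string `j`, given that Alice and Bob use the basis string `b`, Alice sends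
the bit string `i` and Eve applies the attack `A`. -/
def JointAttack.outcomeLaw (A : JointAttack E N) (b i : BitString N) : PMF (BitString N) :=
  measurementLaw b (A.state b i) (A.norm_state b i)

end Attack

/-! ### Generalized BB84 protocols -/

/-- The pairs of an `r × n` matrix `P_C` and an `m × n` matrix `P_K` over the field with two
elements, such that all the `r + m` rows together are linearly independent. -/
def matrixPairs (n r m : ℕ) :
    Finset (Matrix (Fin r) (Fin n) (ZMod 2) × Matrix (Fin m) (Fin n) (ZMod 2)) :=
  open Classical in
  Finset.univ.filter fun M => LinearIndependent (ZMod 2) (Sum.elim M.1.row M.2.row)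

lemma matrixPairs_nonempty {n r m : ℕ} (h : r + m ≤ n) : (matrixPairs n r m).Nonempty := by
  classical
  let f : Fin r ⊕ Fin m → Fin n := fun x => Fin.castLE h (finSumFinEquiv x)
  have hf : Function.Injective f := (Fin.castLE_injective h).comp finSumFinEquiv.injective
  have hli := (Pi.basisFun (ZMod 2) (Fin n)).linearIndependent.comp f hf
  refine ⟨(Matrix.of fun k => Pi.basisFun (ZMod 2) (Fin n) (f (Sum.inl k)),
    Matrix.of fun k => Pi.basisFun (ZMod 2) (Fin n) (f (Sum.inr k))), ?_⟩
  simp only [matrixPairs, Finset.mem_filter, Finset.mem_univ, true_and]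
  convert hli using 1
  ext x : 1
  cases x <;> rfl

/-- A generalized BB84 protocol with `N` qubits, `n` INFO bits, an `r`-bit syndrome and an `m`-bit
final key. It is given by the joint distribution `Pr(b, s)` of the basis string and the string that
selects the INFO bits, with `|s| = n` always, and by the test, a condition `T(c_T, b_T, s) = 1` on
the errors on the TEST bits, the bases of the TEST bits, and `s`. -/
structure Protocol (N n r m : ℕ) where
  rank_le : r + m ≤ n
  info_lt : n < N
  choiceLaw : PMF (BitString N × BitString N)
  hammingNorm_eq : ∀ p ∈ choiceLaw.support, hammingNorm p.2 = n
  passes : (s : BitString N) → (cT bT : TestIndex s → ZMod 2) → Prop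

/-- The classical record of a run: Alice's random choices `i`, `b`, `s`, `P_C`, `P_K`, and the bit
string `j` measured by Bob. -/
structure Run (N n r m : ℕ) where
  i : BitString N
  b : BitString N
  s : BitString N
  PC : Matrix (Fin r) (Fin n) (ZMod 2)
  PK : Matrix (Fin m) (Fin n) (ZMod 2)
  j : BitString N

/-- The string `c_I = i_I ⊕ j_I` of errors on the INFO bits. -/
def Run.infoErrors {N n r m : ℕ} (ω : Run N n r m) : InfoIndex ω.s → ZMod 2 :=
  infoPart ω.s (ω.i + ω.j)

/-- The string `c_T = i_T ⊕ j_T` of errors on the TEST bits. -/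
def Run.testErrors {N n r m : ℕ} (ω : Run N n r m) : TestIndex ω.s → ZMod 2 :=
  testPart ω.s (ω.i + ω.j)

namespace Protocol

variable {N n r m : ℕ} {E : Type*} [NormedAddCommGroup E] [InnerProductSpace ℂ E]

/-- The event `T = 1`. -/
def TestPasses (P : Protocol N n r m) (ω : Run N n r m) : Prop :=
  P.passes ω.s ω.testErrors (testPart ω.s ω.b)

/-- The law of a run under the attack `A`, where, having chosen `b` and `s`, Alice and Bob send and
measure the qubits in the bases given by `used b s`. Alice chooses `i` uniformly, `(b, s)` according
to the protocol, and `(P_C, P_K)` uniformly among the admissible pairs, all independently. -/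
def runLaw (P : Protocol N n r m) (A : JointAttack E N)
    (used : BitString N → BitString N → BitString N) : PMF (Run N n r m) :=
  (PMF.uniformOfFintype (BitString N)).bind fun i =>
    P.choiceLaw.bind fun bs =>
      (PMF.uniformOfFinset (matrixPairs n r m) (matrixPairs_nonempty P.rank_le)).bind fun M =>
        (A.outcomeLaw (used bs.1 bs.2) i).map fun j => ⟨i, bs.1, bs.2, M.1, M.2, j⟩

/-- The law of a run of the real protocol, where the chosen basis string `b` is used. -/
def realLaw (P : Protocol N n r m) (A : JointAttack E N) : PMF (Run N n r m) :=
  P.runLaw A fun b _ => b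

/-- The law of a run of the hypothetical "inverted-INFO-basis" protocol, where `b` and `s` are
chosen as in the real protocol but the basis string `b ⊕ s` is used instead of `b`. -/
def invertedInfoBasisLaw (P : Protocol N n r m) (A : JointAttack E N) : PMF (Run N n r m) :=
  P.runLaw A fun b s => b + s

end Protocol

/-! ### The BB84-INFO-z protocol -/

/-- The set `B` of basis strings of BB84-INFO-z: `n_x` bits are in the `x` basis. -/
def infoZBases (n nz nx : ℕ) : Finset (BitString (n + nz + nx)) :=
  Finset.univ.filter fun b => hammingNorm b = nx

/-- The set `S_b` of BB84-INFO-z: `n` INFO bits, all of them among the bits in the `z` basis. -/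
def infoZSelections (n nz nx : ℕ) (b : BitString (n + nz + nx)) :
    Finset (BitString (n + nz + nx)) :=
  Finset.univ.filter fun s => hammingNorm s = n ∧ hammingNorm (s + b) = n + nx

/-- The pairs `(b, s)` with `b ∈ B` and `s ∈ S_b`. -/
def infoZChoices (n nz nx : ℕ) : Finset (BitString (n + nz + nx) × BitString (n + nz + nx)) :=
  Finset.univ.filter fun p => p.1 ∈ infoZBases n nz nx ∧ p.2 ∈ infoZSelections n nz nx p.1

lemma infoZChoices_nonempty (n nz nx : ℕ) : (infoZChoices n nz nx).Nonempty := by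
  have key : ∀ (a c d : ZMod 2), hammingNorm (Fin.append (Fin.append (fun _ : Fin n => a)
      (fun _ : Fin nz => c)) (fun _ : Fin nx => d)) =
      (if a ≠ 0 then n else 0) + (if c ≠ 0 then nz else 0) + (if d ≠ 0 then nx else 0) := by
    intro a c d
    simp only [hammingNorm, Finset.card_filter, Fin.sum_univ_add, Fin.append_left, Fin.append_right]
    simp
  refine ⟨(Fin.append (Fin.append (fun _ => 0) (fun _ => 0)) (fun _ => 1),
    Fin.append (Fin.append (fun _ => 1) (fun _ => 0)) (fun _ => 0)), ?_⟩
  have hadd : Fin.append (Fin.append (fun _ : Fin n => (1 : ZMod 2)) (fun _ : Fin nz => 0))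
      (fun _ : Fin nx => 0) + Fin.append (Fin.append (fun _ => 0) (fun _ => 0)) (fun _ => 1)
      = Fin.append (Fin.append (fun _ => 1) (fun _ => 0)) (fun _ => 1) := by
    funext k
    refine Fin.addCases (fun k => ?_) (fun k => ?_) k
    · refine Fin.addCases (fun k => ?_) (fun k => ?_) k <;> simp
    · simp
  simp [infoZChoices, infoZBases, infoZSelections, hadd, key]

/-- The BB84-INFO-z protocol with `n` INFO, `n_z` TEST-Z and `n_x` TEST-X bits: `(b, s)` is uniform
on the pairs with `b ∈ B` and `s ∈ S_b`, and the test passes if and only if there are at most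
`n_z p_{a,z}` errors on the TEST-Z bits and at most `n_x p_{a,x}` errors on the TEST-X bits. -/
def infoZ (n nz nx r m : ℕ) (pz px : ℝ) (hx : 0 < nx) (hrm : r + m ≤ n) :
    Protocol (n + nz + nx) n r m where
  rank_le := hrm
  info_lt := by omega
  choiceLaw := PMF.uniformOfFinset (infoZChoices n nz nx) (infoZChoices_nonempty n nz nx)
  hammingNorm_eq p hp := by
    have h := (PMF.mem_support_uniformOfFinset_iff (infoZChoices_nonempty n nz nx) p).1 hp
    simp only [infoZChoices, infoZSelections, Finset.mem_filter] at h
    exact h.2.2.2.1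
  passes s cT bT :=
    (hammingNorm (fun k : {k : TestIndex s // bT k = 0} => cT k) : ℝ) ≤ nz * pz ∧
      (hammingNorm (fun k : {k : TestIndex s // bT k = 1} => cT k) : ℝ) ≤ nx * px

end BB84

end

/-! Bob's outcome law depends on `b` and `s` only through the used string `b0 = b + s`. So once `b0`
and Alice's `i` are fixed, the error string `c` is independent of `s`, and the ones of `s` form a
uniformly random `n`-subset of the `n + nx` ones of `b0`: INFO is a random sample of the `x`-basis
positions, and TEST-X is the rest. The attack matters only through `c`, and the bound holds for
every `c`.

If the sample has error rate at least `px + ε` and the rest at most `px`, the sample exceeds the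
pooled rate by at least `nx / (n + nx) * ε`. Hoeffding's bound for sampling without replacement
(`card_powersetCard_filter_le`) makes this exponentially rare. It follows from Chernoff's method:
`sum_powersetCard_one_add_pow_le` compares the hypergeometric moment generating function with the
binomial one, and `one_add_exp_sub_one_mul_le` bounds each factor of the latter.
`card_splits_filter_le` translates this to strings, and `invertedInfoBasisLaw_le` averages over
`b0`, `i` and `c`. -/

/-! ### Tail bound for sampling without replacement. -/

lemma Nat.descFactorial_mul_pow_le {w M : ℕ} (h : w ≤ M) (k : ℕ) :
    w.descFactorial k * M ^ k ≤ M.descFactorial k * w ^ k := by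
  induction k with
  | zero => simp
  | succ k ih =>
    have h1 : (w - k) * M ≤ (M - k) * w := by
      rw [Nat.sub_mul, Nat.sub_mul, Nat.mul_comm w M]
      exact Nat.sub_le_sub_left (Nat.mul_le_mul_left k h) _
    rw [Nat.descFactorial_succ, Nat.descFactorial_succ, pow_succ, pow_succ]
    calc (w - k) * w.descFactorial k * (M ^ k * M)
        = ((w - k) * M) * (w.descFactorial k * M ^ k) := by ring
      _ ≤ ((M - k) * w) * (M.descFactorial k * w ^ k) := Nat.mul_le_mul h1 ih
      _ = _ := by ring

/-- Drawing without replacement hits a marked set `k` times in a row no more often than drawing with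
replacement: each ratio `(w - i) / (M - i)` is at most `w / M`. -/
lemma Nat.choose_mul_pow_le {w M : ℕ} (h : w ≤ M) (k : ℕ) :
    w.choose k * M ^ k ≤ M.choose k * w ^ k := by
  have := Nat.descFactorial_mul_pow_le h k
  rw [Nat.descFactorial_eq_factorial_mul_choose, Nat.descFactorial_eq_factorial_mul_choose,
    mul_assoc, mul_assoc] at this
  exact Nat.le_of_mul_le_mul_left this (Nat.factorial_pos k)

open Finset in
/-- The generating function of the hypergeometric distribution. -/
lemma sum_powersetCard_one_add_pow {α : Type*} [DecidableEq α] {U W : Finset α} (hW : W ⊆ U)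
    (n : ℕ) (a : ℝ) :
    ∑ S ∈ powersetCard n U, (1 + a) ^ #(S ∩ W) =
      ∑ k ∈ range (n + 1), ((#W).choose k * (#U - k).choose (n - k) : ℕ) * a ^ k := by
  -- Expand the power over the subsets `T` of `S ∩ W` and exchange the sums; the inner sum then
  -- counts the `n`-sets that contain `T`.
  calc ∑ S ∈ powersetCard n U, (1 + a) ^ #(S ∩ W)
      = ∑ S ∈ powersetCard n U, ∑ T ∈ W.powerset, if T ⊆ S then a ^ #T else 0 := by
        refine sum_congr rfl fun S _ => ?_
        rw [← prod_const, prod_one_add, ← sum_filter]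
        refine sum_congr ?_ fun T _ => by rw [prod_const]
        ext T
        simp only [mem_powerset, mem_filter, subset_inter_iff, and_comm]
    _ = ∑ T ∈ W.powerset, (#{S ∈ powersetCard n U | T ⊆ S} : ℝ) * a ^ #T := by
        rw [sum_comm]
        refine sum_congr rfl fun T _ => ?_
        rw [← sum_filter, sum_const, nsmul_eq_mul]
    _ = ∑ T ∈ W.powerset,
          if #T ∈ range (n + 1) then ((#U - #T).choose (n - #T) : ℝ) * a ^ #T else 0 := by
        refine sum_congr rfl fun T hT => ?_
        have hTU := (mem_powerset.1 hT).trans hW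
        split_ifs with h
        · rw [card_filter_powersetCard_subset _ _ _ hTU (by simpa [Nat.lt_succ_iff] using h)]
        · rw [filter_false_of_mem]
          · simp
          · intro S hS hTS
            have := card_le_card hTS
            rw [(mem_powersetCard.1 hS).2] at this
            simp at h
            omega
    _ = ∑ k ∈ range (n + 1), ∑ T ∈ powersetCard k W,
          ((#U - k).choose (n - k) : ℝ) * a ^ k := by
        rw [← sum_filter, ← sum_fiberwise_of_maps_to (g := card) (t := range (n + 1))
          fun T hT => (mem_filter.1 hT).2]
        refine sum_congr rfl fun k hk => ?_
        rw [filter_filter, powersetCard_eq_filter]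
        refine sum_congr (filter_congr fun T _ => ?_) fun T hT => by rw [(mem_filter.1 hT).2]
        exact ⟨fun h => h.2, fun h => ⟨h ▸ hk, h⟩⟩
    _ = _ := by
        refine sum_congr rfl fun k _ => ?_
        rw [sum_const, card_powersetCard, nsmul_eq_mul]
        push_cast
        ring

open Finset in
/-- The moment generating function of the hypergeometric distribution is at most that of the
binomial distribution with the same mean. -/
lemma sum_powersetCard_one_add_pow_le {α : Type*} [DecidableEq α] {U W : Finset α} (hW : W ⊆ U)
    (n : ℕ) {a : ℝ} (ha : 0 ≤ a) (hU : 0 < #U) :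
    ∑ S ∈ powersetCard n U, (1 + a) ^ #(S ∩ W) ≤
      (#U).choose n * (1 + a * ((#W : ℝ) / #U)) ^ n := by
  rw [sum_powersetCard_one_add_pow hW, add_comm (1 : ℝ) (a * _), add_pow, mul_sum]
  -- Both sides are polynomials in `a ≥ 0`, so comparing coefficients is enough.
  refine sum_le_sum fun k hk => ?_
  have hkn : k ≤ n := Nat.lt_succ_iff.1 (mem_range.1 hk)
  have hU' : (0 : ℝ) < (#U : ℝ) := by exact_mod_cast hU
  have h1 : ((#W).choose k : ℝ) ≤ (#U).choose k * ((#W : ℝ) / #U) ^ k := by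
    rw [div_pow, ← mul_div_assoc, le_div_iff₀ (by positivity)]
    exact_mod_cast Nat.choose_mul_pow_le (card_le_card hW) k
  have h2 : ((#U).choose n * n.choose k : ℝ) = (#U).choose k * (#U - k).choose (n - k) := by
    exact_mod_cast Nat.choose_mul (n := #U) hkn
  push_cast
  calc ((#W).choose k : ℝ) * (#U - k).choose (n - k) * a ^ k
      ≤ ((#U).choose k * ((#W : ℝ) / #U) ^ k) * (#U - k).choose (n - k) * a ^ k := by gcongr
    _ = ((#U).choose k * (#U - k).choose (n - k)) * ((#W : ℝ) / #U) ^ k * a ^ k := by ring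
    _ = _ := by rw [← h2, mul_pow]; ring

open MeasureTheory ProbabilityTheory in
/-- Hoeffding's lemma for a Bernoulli variable. -/
lemma one_add_exp_sub_one_mul_le {p : ℝ} (h0 : 0 ≤ p) (h1 : p ≤ 1) (x : ℝ) :
    1 + (Real.exp x - 1) * p ≤ Real.exp (x * p + x ^ 2 / 8) := by
  -- The Bernoulli law on the real line, whose identity function is bounded in `[0, 1]`; the
  -- sub-Gaussian bound concerns the centred variable, hence the later factor `exp (x * p)`.
  let μ : Measure ℝ := ENNReal.ofReal (1 - p) • Measure.dirac 0 + ENNReal.ofReal p • Measure.dirac 1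
  have hμ : IsProbabilityMeasure μ := ⟨by
    simp only [μ, Measure.add_apply, Measure.smul_apply, measure_univ, smul_eq_mul, mul_one]
    rw [← ENNReal.ofReal_add (by linarith) h0]; simp⟩
  have hint : ∀ f : ℝ → ℝ, ∫ y, f y ∂μ = (1 - p) * f 0 + p * f 1 := by
    intro f
    rw [integral_add_measure, integral_smul_measure, integral_smul_measure]
    · simp [ENNReal.toReal_ofReal, h0, h1]
    · exact (integrable_dirac (by simp)).smul_measure (by simp)
    · exact (integrable_dirac (by simp)).smul_measure (by simp)
  have hs := (hasSubgaussianMGF_of_mem_Icc (μ := μ) (X := id) (a := 0) (b := 1)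
    measurable_id.aemeasurable (by
      rw [ae_add_measure_iff]
      exact ⟨Measure.ae_smul_measure (by simp [ae_dirac_eq]) _,
        Measure.ae_smul_measure (by simp [ae_dirac_eq]) _⟩)).mgf_le x
  rw [mgf, hint] at hs
  simp only [hint, id] at hs
  have hc : ((((‖(1 : ℝ) - 0‖₊ / 2) ^ 2 : NNReal)) : ℝ) * x ^ 2 / 2 = x ^ 2 / 8 := by
    simp; ring
  rw [hc] at hs
  have e1 : Real.exp (x * (0 - ((1 - p) * 0 + p * 1))) = Real.exp (-(x * p)) := by congr 1; ring
  have e2 : Real.exp (x * (1 - ((1 - p) * 0 + p * 1))) = Real.exp x * Real.exp (-(x * p)) := by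
    rw [← Real.exp_add]; congr 1; ring
  rw [e1, e2] at hs
  rw [Real.exp_add]
  have h3 : Real.exp (x * p) * Real.exp (-(x * p)) = 1 := by rw [← Real.exp_add]; simp
  have h4 := mul_le_mul_of_nonneg_left hs (Real.exp_pos (x * p)).le
  calc 1 + (Real.exp x - 1) * p
      = (Real.exp (x * p) * Real.exp (-(x * p))) * (1 + (Real.exp x - 1) * p) := by
        rw [h3, one_mul]
    _ ≤ _ := by linarith

open Finset in
/-- Hoeffding's inequality for sampling without replacement. -/
lemma card_powersetCard_filter_le {α : Type*} [DecidableEq α] {U W : Finset α} (hW : W ⊆ U)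
    (n : ℕ) {δ : ℝ} (hδ : 0 ≤ δ) (hU : 0 < #U) :
    (#{S ∈ powersetCard n U | n * ((#W : ℝ) / #U + δ) ≤ #(S ∩ W)} : ℝ) ≤
      Real.exp (-2 * n * δ ^ 2) * (#U).choose n := by
  set p : ℝ := (#W : ℝ) / #U with hp
  have hp1 : p ≤ 1 := div_le_one_of_le₀ (by exact_mod_cast card_le_card hW) (by positivity)
  -- The Chernoff parameter `4 * δ` minimizes `x ^ 2 / 8 - x * δ`, with minimum `-2 * δ ^ 2`.
  have key := sum_powersetCard_one_add_pow_le hW n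
    (a := Real.exp (4 * δ) - 1) (by linarith [Real.one_le_exp (x := 4 * δ) (by linarith)]) hU
  have hle : (#{S ∈ powersetCard n U | n * (p + δ) ≤ #(S ∩ W)} : ℝ) * Real.exp (4 * δ * (n * (p + δ)))
      ≤ ∑ S ∈ powersetCard n U, (1 + (Real.exp (4 * δ) - 1)) ^ #(S ∩ W) := by
    rw [← nsmul_eq_mul]
    refine (card_nsmul_le_sum _ _ _ fun S hS => ?_).trans
      (sum_le_sum_of_subset_of_nonneg (filter_subset _ _) fun S _ _ => ?_)
    · rw [add_sub_cancel, ← Real.exp_nat_mul, mul_comm (#(S ∩ W) : ℝ)]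
      exact Real.exp_le_exp.2 (mul_le_mul_of_nonneg_left (mem_filter.1 hS).2 (by positivity))
    · rw [add_sub_cancel]; positivity
  have hb : (1 + (Real.exp (4 * δ) - 1) * p) ^ n ≤ Real.exp (n * (4 * δ * p + (4 * δ) ^ 2 / 8)) := by
    rw [Real.exp_nat_mul]
    refine pow_le_pow_left₀ ?_ (one_add_exp_sub_one_mul_le (by positivity) hp1 _) n
    have := Real.one_le_exp (x := 4 * δ) (by linarith)
    have : 0 ≤ (Real.exp (4 * δ) - 1) * p := mul_nonneg (by linarith) (by positivity)
    linarith
  have hexp : Real.exp (n * (4 * δ * p + (4 * δ) ^ 2 / 8)) =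
      Real.exp (-2 * n * δ ^ 2) * Real.exp (4 * δ * (n * (p + δ))) := by
    rw [← Real.exp_add]; congr 1; ring
  refine le_of_mul_le_mul_right ?_ (Real.exp_pos (4 * δ * (n * (p + δ))))
  calc _ ≤ _ := hle
    _ ≤ _ := key
    _ ≤ _ := mul_le_mul_of_nonneg_left hb (by positivity)
    _ = _ := by rw [hexp]; ring

/-! ### Choices of the INFO bits as random subsets. -/

namespace BB84

/-- The set of positions of the 1-bits of a string. -/
def ones {N : ℕ} (x : BitString N) : Finset (Fin N) := Finset.univ.filter fun k => x k ≠ 0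

lemma mem_ones {N : ℕ} {x : BitString N} {k : Fin N} : k ∈ ones x ↔ x k ≠ 0 := by simp [ones]

lemma card_ones {N : ℕ} (x : BitString N) : (ones x).card = hammingNorm x := rfl

lemma ones_injective {N : ℕ} : Function.Injective (ones (N := N)) := by
  intro x y h
  funext k
  have hk : x k ≠ 0 ↔ y k ≠ 0 := by rw [← mem_ones, h, mem_ones]
  have : ∀ a b : ZMod 2, (a ≠ 0 ↔ b ≠ 0) → a = b := by decide
  exact this _ _ hk

lemma ones_surjective {N : ℕ} : Function.Surjective (ones (N := N)) := by
  intro S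
  refine ⟨fun k => if k ∈ S then 1 else 0, ?_⟩
  ext k
  simp [mem_ones]

lemma ones_add {N : ℕ} (x y : BitString N) : ones (x + y) = symmDiff (ones x) (ones y) := by
  ext k
  have : ∀ a b : ZMod 2, a + b ≠ 0 ↔ (a ≠ 0 ∧ ¬ b ≠ 0 ∨ b ≠ 0 ∧ ¬ a ≠ 0) := by decide
  rw [Finset.mem_symmDiff, mem_ones, mem_ones, mem_ones]
  exact this _ _

/-- The strings `s` with `n` 1-bits such that `b0 + s` has `nx` 1-bits. -/
def splits {N : ℕ} (n nx : ℕ) (b0 : BitString N) : Finset (BitString N) :=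
  Finset.univ.filter fun s => hammingNorm s = n ∧ hammingNorm (b0 + s) = nx

/-- The cardinalities force inclusion: a one of `s` outside `b0` would make the symmetric difference
larger than `nx`. -/
lemma mem_splits {N n nx : ℕ} {b0 : BitString N} (hb : hammingNorm b0 = n + nx)
    {s : BitString N} :
    s ∈ splits n nx b0 ↔ ones s ∈ Finset.powersetCard n (ones b0) := by
  simp only [splits, Finset.mem_filter, Finset.mem_univ, true_and, Finset.mem_powersetCard,
    ← card_ones, ones_add] at hb ⊢
  have h1 : (symmDiff (ones b0) (ones s)).card =
      (ones b0 \ ones s).card + (ones s \ ones b0).card :=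
    Finset.card_union_of_disjoint disjoint_sdiff_sdiff
  have h2 := Finset.card_sdiff_add_card_inter (ones b0) (ones s)
  have h3 := Finset.card_sdiff_add_card_inter (ones s) (ones b0)
  rw [Finset.inter_comm] at h3
  rw [h1, ← Finset.sdiff_eq_empty_iff_subset, ← Finset.card_eq_zero]
  omega

lemma card_splits {N n nx : ℕ} {b0 : BitString N} (hb : hammingNorm b0 = n + nx) :
    (splits n nx b0).card = (n + nx).choose n := by
  rw [← hb, ← card_ones, ← Finset.card_powersetCard]
  refine Finset.card_bij (fun s _ => ones s) (fun s hs => (mem_splits hb).1 hs)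
    (fun _ _ _ _ h => ones_injective h) fun S hS => ?_
  obtain ⟨s, rfl⟩ := ones_surjective S
  exact ⟨s, (mem_splits hb).2 hS, rfl⟩

lemma hammingNorm_infoPart {N : ℕ} (s c : BitString N) :
    hammingNorm (infoPart s c) = (ones s ∩ ones c).card := by
  rw [hammingNorm]
  refine Finset.card_bij (fun k _ => k.1) (fun k hk => ?_) (fun _ _ _ _ h => Subtype.ext h)
    fun k hk => ?_
  · have hc : c k.1 ≠ 0 := (Finset.mem_filter.1 hk).2
    simp [mem_ones, hc, k.2]
  · rw [Finset.mem_inter, mem_ones, mem_ones] at hk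
    have h1 : ∀ a : ZMod 2, a ≠ 0 → a = 1 := by decide
    exact ⟨⟨k, h1 _ hk.1⟩, Finset.mem_filter.2 ⟨Finset.mem_univ _, hk.2⟩, rfl⟩

lemma hammingNorm_testPart_filter {N : ℕ} (s b c : BitString N) :
    hammingNorm (fun k : {k : TestIndex s // testPart s b k = 1} => testPart s c k) =
      ((ones b ∩ ones c) \ ones s).card := by
  rw [hammingNorm]
  refine Finset.card_bij (fun k _ => k.1.1) (fun k hk => ?_)
    (fun _ _ _ _ h => Subtype.ext (Subtype.ext h)) fun k hk => ?_
  · have hc : c k.1.1 ≠ 0 := (Finset.mem_filter.1 hk).2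
    have h2 : b k.1.1 = 1 := k.2
    simp [mem_ones, hc, k.1.2, h2]
  · rw [Finset.mem_sdiff, Finset.mem_inter, mem_ones, mem_ones, mem_ones, not_not] at hk
    have h1 : ∀ a : ZMod 2, a ≠ 0 → a = 1 := by decide
    exact ⟨⟨⟨k, hk.2⟩, h1 _ hk.1.1⟩, Finset.mem_filter.2 ⟨Finset.mem_univ _, hk.1.2⟩, rfl⟩

open Classical in
/-- Given the used basis string `b0` and the error string `c`, a random sample of `n` of the `x`
basis positions has an error rate that exceeds the one on the remaining `nx` positions by `ε` with
small probability only. -/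
lemma card_splits_filter_le {N n nx : ℕ} (hn : 0 < n) (q ε : ℝ) (hε : 0 ≤ ε)
    {b0 : BitString N} (hb : hammingNorm b0 = n + nx) (c : BitString N) :
    (((splits n nx b0).filter fun s => n * (q + ε) ≤ hammingNorm (infoPart s c) ∧
      (hammingNorm (fun k : {k : TestIndex s // testPart s (b0 + s) k = 1} => testPart s c k) : ℝ)
        ≤ nx * q).card : ℝ) ≤
      Real.exp (-2 * ((nx : ℝ) / (n + nx)) ^ 2 * n * ε ^ 2) * (splits n nx b0).card := by
  have hM : ((ones b0).card : ℝ) = n + nx := by rw [card_ones, hb]; push_cast; rfl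
  have hn' : (0 : ℝ) < n := by exact_mod_cast hn
  -- The pooled rate is the weighted mean of the two rates, so a gap of `ε` between sample and rest
  -- is a gap of `nx / (n + nx) * ε` between sample and pool.
  have key := card_powersetCard_filter_le (U := ones b0) (W := ones b0 ∩ ones c)
    Finset.inter_subset_left n (δ := nx / (n + nx) * ε) (by positivity)
    (by rw [card_ones, hb]; omega)
  have e : -2 * (n : ℝ) * (nx / (n + nx) * ε) ^ 2 =
      -2 * ((nx : ℝ) / (n + nx)) ^ 2 * n * ε ^ 2 := by ring
  rw [e] at key
  rw [card_splits hb]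
  rw [card_ones, hb] at key
  refine le_trans (Nat.cast_le.2 ?_) key
  refine Finset.card_le_card_of_injOn ones (fun s hs => ?_) ones_injective.injOn
  simp only [Finset.coe_filter, Set.mem_ofPred_eq] at hs ⊢
  obtain ⟨hs, h1, h2⟩ := hs
  have hs' := (mem_splits hb).1 hs
  refine ⟨hs', ?_⟩
  have hsub := (Finset.mem_powersetCard.1 hs').1
  rw [hammingNorm_infoPart] at h1
  rw [hammingNorm_testPart_filter] at h2
  have e1 : ones s ∩ (ones b0 ∩ ones c) = ones s ∩ ones c := by
    rw [← Finset.inter_assoc, Finset.inter_eq_left.2 hsub]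
  -- Adding `s` changes `b0` only at positions that are removed here.
  have e2 : (ones (b0 + s) ∩ ones c) \ ones s = (ones b0 ∩ ones c) \ ones s := by
    rw [ones_add]
    ext k
    simp only [Finset.mem_sdiff, Finset.mem_inter, Finset.mem_symmDiff]
    tauto
  have e3 := Finset.card_sdiff_add_card_inter (ones b0 ∩ ones c) (ones s)
  rw [Finset.inter_comm _ (ones s), e1] at e3
  rw [e2] at h2
  rw [e1, ← e3]
  push_cast
  set x : ℝ := ((ones s ∩ ones c).card : ℝ)
  set y : ℝ := (((ones b0 ∩ ones c) \ ones s).card : ℝ)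
  have hMpos : (0 : ℝ) < n + nx := by positivity
  have : (n : ℝ) * ((y + x) / (n + nx) + nx / (n + nx) * ε) = n * (y + x + nx * ε) / (n + nx) := by
    field_simp
  rw [this, div_le_iff₀ hMpos]
  have h3 := mul_le_mul_of_nonneg_left h1 (Nat.cast_nonneg (α := ℝ) nx)
  have h4 := mul_le_mul_of_nonneg_left h2 hn'.le
  linarith

/-! ### Averaging over the protocol's randomness. -/

lemma mem_infoZChoices {n nz nx : ℕ} {p : BitString (n + nz + nx) × BitString (n + nz + nx)} :
    p ∈ infoZChoices n nz nx ↔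
      hammingNorm (p.1 + p.2) = n + nx ∧ p.2 ∈ splits n nx (p.1 + p.2) := by
  have h2 : ∀ a b : ZMod 2, a + b + b = a := by decide
  have h : p.1 + p.2 + p.2 = p.1 := funext fun k => h2 _ _
  simp only [infoZChoices, infoZBases, infoZSelections, splits, Finset.mem_filter,
    Finset.mem_univ, true_and, h, add_comm p.2 p.1]
  tauto

/-- A sum over the choices `(b, s)` of BB84-INFO-z, arranged by the used basis string `b + s`. -/
lemma sum_infoZChoices {R : Type*} [AddCommMonoid R] (n nz nx : ℕ)
    (f : BitString (n + nz + nx) → BitString (n + nz + nx) → R) :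
    ∑ p ∈ infoZChoices n nz nx, f (p.1 + p.2) p.2 =
      ∑ b0 with hammingNorm b0 = n + nx, ∑ s ∈ splits n nx b0, f b0 s := by
  have h2 : ∀ a b : ZMod 2, a + b + b = a := by decide
  have h : ∀ x y : BitString (n + nz + nx), x + y + y = x := fun x y => funext fun k => h2 _ _
  rw [Finset.sum_sigma']
  refine Finset.sum_nbij' (fun p => ⟨p.1 + p.2, p.2⟩) (fun q => (q.1 + q.2, q.2)) ?_ ?_ ?_ ?_ ?_
  · intro p hp
    simpa using mem_infoZChoices.1 hp
  · intro q hq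
    simpa [mem_infoZChoices, h] using hq
  · intro p _
    simp [h]
  · intro q _
    simp [h]
  · intro p _
    rfl

lemma tsum_mul_le_of_forall_le {α : Type*} (p : PMF α) {f : α → ENNReal} {B : ENNReal}
    (h : ∀ a, f a ≤ B) : ∑' a, p a * f a ≤ B :=
  calc ∑' a, p a * f a ≤ ∑' a, p a * B := ENNReal.tsum_le_tsum fun a => mul_le_mul_right (h a) _
    _ = B := by rw [ENNReal.tsum_mul_right, p.tsum_coe, one_mul]

open Classical in
/-- If, for every used basis string and every error string, the event `ev` holds for at most a
fraction `B` of the choices of the INFO bits, then it has probability at most `B`. -/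
lemma invertedInfoBasisLaw_le {E : Type*} [NormedAddCommGroup E] [InnerProductSpace ℂ E]
    {n nz nx r m : ℕ} (pz px : ℝ) (hnx : 0 < nx) (hrm : r + m ≤ n)
    (A : JointAttack E (n + nz + nx))
    (ev : BitString (n + nz + nx) → BitString (n + nz + nx) → BitString (n + nz + nx) → Prop)
    {B : ℝ} (hB0 : 0 ≤ B)
    (hB : ∀ b0, hammingNorm b0 = n + nx → ∀ c,
      (((splits n nx b0).filter fun s => ev b0 s c).card : ℝ) ≤ B * (splits n nx b0).card) :
    (((infoZ n nz nx r m pz px hnx hrm).invertedInfoBasisLaw A).toOuterMeasure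
      {ω | ev (ω.b + ω.s) ω.s (ω.i + ω.j)}).toReal ≤ B := by
  refine ENNReal.toReal_le_of_le_ofReal hB0 ?_
  rw [Protocol.invertedInfoBasisLaw, Protocol.runLaw, PMF.toOuterMeasure_bind_apply]
  -- The bound holds for each fixed `i`, so uniformity of `i` plays no role.
  refine tsum_mul_le_of_forall_le _ fun i => ?_
  have hinner : ∀ bs : BitString (n + nz + nx) × BitString (n + nz + nx),
      ((PMF.uniformOfFinset (matrixPairs n r m) (matrixPairs_nonempty hrm)).bind fun M =>
        (A.outcomeLaw (bs.1 + bs.2) i).map fun j =>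
          (⟨i, bs.1, bs.2, M.1, M.2, j⟩ : Run (n + nz + nx) n r m)).toOuterMeasure
        {ω | ev (ω.b + ω.s) ω.s (ω.i + ω.j)} ≤
      ∑ j, A.outcomeLaw (bs.1 + bs.2) i j * if ev (bs.1 + bs.2) bs.2 (i + j) then 1 else 0 := by
    intro bs
    rw [PMF.toOuterMeasure_bind_apply]
    -- The event does not involve the matrices.
    refine tsum_mul_le_of_forall_le _ fun M => le_of_eq ?_
    rw [PMF.toOuterMeasure_map_apply, PMF.toOuterMeasure_apply_fintype]
    refine Finset.sum_congr rfl fun j _ => ?_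
    simp [Set.indicator_apply]
  rw [PMF.toOuterMeasure_bind_apply]
  refine (ENNReal.tsum_le_tsum fun bs => mul_le_mul_right (hinner bs) _).trans ?_
  have hne := infoZChoices_nonempty n nz nx
  have hcard : ((infoZChoices n nz nx).card : ENNReal) ≠ 0 := by
    simpa using hne.ne_empty
  calc ∑' bs, (infoZ n nz nx r m pz px hnx hrm).choiceLaw bs *
        ∑ j, A.outcomeLaw (bs.1 + bs.2) i j * (if ev (bs.1 + bs.2) bs.2 (i + j) then 1 else 0)
      = ∑ bs ∈ infoZChoices n nz nx, ((infoZChoices n nz nx).card : ENNReal)⁻¹ *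
        ∑ j, A.outcomeLaw (bs.1 + bs.2) i j *
          (if ev (bs.1 + bs.2) bs.2 (i + j) then 1 else 0) := by
        rw [tsum_fintype, ← Finset.sum_subset (Finset.subset_univ (infoZChoices n nz nx))
          fun bs _ hbs => ?_]
        · refine Finset.sum_congr rfl fun bs hbs => ?_
          rw [infoZ, PMF.uniformOfFinset_apply_of_mem _ hbs]
        · rw [infoZ, PMF.uniformOfFinset_apply_of_notMem _ hbs, zero_mul]
    _ = ((infoZChoices n nz nx).card : ENNReal)⁻¹ *
        ∑ b0 with hammingNorm b0 = n + nx, ∑ j, A.outcomeLaw b0 i j *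
          (((splits n nx b0).filter fun s => ev b0 s (i + j)).card : ENNReal) := by
        rw [← Finset.mul_sum, sum_infoZChoices n nz nx fun b0 s =>
          ∑ j, A.outcomeLaw b0 i j * (if ev b0 s (i + j) then 1 else 0)]
        congr 1
        refine Finset.sum_congr rfl fun b0 _ => ?_
        -- The key exchange: the weight of `j` depends on `b0` and not on `s`, so the sum over `s`
        -- becomes a count at fixed error string `i + j`.
        rw [Finset.sum_comm]
        refine Finset.sum_congr rfl fun j _ => ?_
        rw [← Finset.mul_sum, Finset.sum_boole]
    _ ≤ ((infoZChoices n nz nx).card : ENNReal)⁻¹ *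
        ∑ b0 with hammingNorm b0 = n + nx, ENNReal.ofReal B * (splits n nx b0).card := by
        gcongr with b0 hb0
        rw [← tsum_fintype (L := .unconditional _)]
        refine tsum_mul_le_of_forall_le _ fun j => ?_
        have := ENNReal.ofReal_le_ofReal (hB b0 (Finset.mem_filter.1 hb0).2 (i + j))
        rwa [ENNReal.ofReal_mul hB0, ENNReal.ofReal_natCast, ENNReal.ofReal_natCast] at this
    _ = ((infoZChoices n nz nx).card : ENNReal)⁻¹ *
        (ENNReal.ofReal B * (infoZChoices n nz nx).card) := by
        congr 1
        -- The same rearrangement applied to the constant `1` shows that the sizes of the fibres add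
        -- up to the number of choices.
        rw [← Finset.mul_sum, Finset.card_eq_sum_ones (infoZChoices n nz nx),
          sum_infoZChoices n nz nx fun _ _ => 1]
        simp
    _ = ENNReal.ofReal B := by
        rw [mul_left_comm, ENNReal.inv_mul_cancel hcard (ENNReal.natCast_ne_top _), mul_one]

end BB84

theorem mainTheorem10 {E : Type*} [NormedAddCommGroup E] [InnerProductSpace ℂ E] [CompleteSpace E]
    (n nz nx r m : ℕ) (hn : 0 < n) (hnz : 0 < nz) (hnx : 0 < nx) (hrm : r + m ≤ n)
    (pz px ε : ℝ) (hpz : 0 < pz) (hpx : 0 < px) (hε : 0 < ε)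
    (t : ℤ) (ht : (t : ℝ) = n * (px + ε)) (hhalf : px + ε ≤ 1 / 2)
    (A : BB84.JointAttack E (n + nz + nx)) :
    (((BB84.infoZ n nz nx r m pz px hnx hrm).invertedInfoBasisLaw A).toOuterMeasure
      {ω | (t : ℝ) / n ≤ (hammingNorm ω.infoErrors : ℝ) / n ∧
        (BB84.infoZ n nz nx r m pz px hnx hrm).TestPasses ω}).toReal ≤
      Real.exp (-2 * ((nx : ℝ) / (n + nx)) ^ 2 * n * ε ^ 2) := by
  classical
  have hn' : (0 : ℝ) < n := by exact_mod_cast hn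
  have key := BB84.invertedInfoBasisLaw_le pz px hnx hrm A
    (fun b0 s c => n * (px + ε) ≤ hammingNorm (BB84.infoPart s c) ∧
      (hammingNorm (fun k : {k : BB84.TestIndex s // BB84.testPart s (b0 + s) k = 1} =>
        BB84.testPart s c k) : ℝ) ≤ nx * px)
    (Real.exp_pos _).le
    (fun b0 hb c => by
      convert BB84.card_splits_filter_le hn px ε hε.le hb c)
  refine le_trans (ENNReal.toReal_mono ?_ (MeasureTheory.measure_mono ?_)) key
  · exact ((PMF.toOuterMeasure_mono _ (Set.subset_univ _)).trans_lt
      ((((PMF.toOuterMeasure_apply_eq_one_iff _ _).2 (Set.subset_univ _)).le).trans_lt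
        ENNReal.one_lt_top)).ne
  -- The TEST-Z condition is dropped, which only enlarges the event; `b` is recovered as `b0 + s` in
  -- characteristic two.
  · rintro ω ⟨h1, _, h2⟩
    have h0 : ∀ a b : ZMod 2, a + b + b = a := by decide
    have h : ω.b + ω.s + ω.s = ω.b := funext fun k => h0 _ _
    rw [div_le_div_iff_of_pos_right hn', ht] at h1
    refine ⟨h1, ?_⟩
    rw [h]
    exact h2
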